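/- Let $X$ be a compact metrizable space and let $\mu$ be a nonatomic Borel measure on $X$ (it is enough that $\mu(\{x\})=0$ for every $x\in X$; $\mu$ need not be finite or $\sigma$-finite). Let $J_f(\mu)$ (respectively, $J_0(\mu)$) be the collection of Borel sets in $X$ that can be covered by countably many compact sets of finite $\mu$-measure (respectively, of $\mu$-measure zero). (i) Assume that every Borel set $B\notin J_f(\mu)$ contains a Borel set $C\notin J_f(\mu)$ with $\mu(C)<\infty$. Then for every Borel set $B\subseteq X$ with $B\notin J_f(\mu)$ there is a function $\varphi$ assigning to each $c\in 2^{\mathbb N}$ a Borel set $\varphi(c)\subseteq B$ with $\varphi(c)\notin J_f(\mu)$, such that $\varphi(c)\cap\varphi(d)=\emptyset$ for all distinct $c,d\in 2^{\mathbb N}$. (ii) Assume that $\mu$ is semifinite, i.e., each Borel set of positive $\mu$-measure contains a Borel set of finite positive $\mu$-measure. Then for every Borel set $B\subseteq X$ with $B\notin J_0(\mu)$ there is a function $\varphi$ assigning to each $c\in 2^{\mathbb N}$ a Borel set $\varphi(c)\subseteq B$ with $\varphi(c)\notin J_0(\mu)$, such that $\varphi(c)\cap\varphi(d)=\emptyset$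 for all distinct $c,d\in 2^{\mathbb N}$. -/

import Mathlib

open MeasureTheory Set

namespace BorelIdeal

/-- The Borel sets of `X` that can be covered by countably many compact sets of finite
`μ`-measure. -/
def Jf {X : Type*} [TopologicalSpace X] [MeasurableSpace X] (μ : Measure X) : Set (Set X) :=
  {A | MeasurableSet A ∧
    ∃ K : ℕ → Set X, (∀ n, IsCompact (K n) ∧ μ (K n) < ⊤) ∧ A ⊆ ⋃ n, K n}

/-- The Borel sets of `X` that can be covered by countably many compact sets of `μ`-measure
zero. -/
def J0 {X : Type*} [TopologicalSpace X] [MeasurableSpace X] (μ : Measure X) : Set (Set X) :=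
  {A | MeasurableSet A ∧
    ∃ K : ℕ → Set X, (∀ n, IsCompact (K n) ∧ μ (K n) = 0) ∧ A ⊆ ⋃ n, K n}

/-- Every measurable set of positive measure contains a measurable set of finite positive
measure. -/
def IsSemifinite {X : Type*} [MeasurableSpace X] (μ : Measure X) : Prop :=
  ∀ A : Set X, MeasurableSet A → 0 < μ A →
    ∃ C : Set X, C ⊆ A ∧ MeasurableSet C ∧ 0 < μ C ∧ μ C < ⊤

end BorelIdeal

open Filter Topology
open scoped ENNReal

universe u

namespace BorelIdeal

/-! Both ideals are treated together: `CoveredBy m` gives `Jf` for `m k = k` and `J0` for `m k = 0`.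
In either case it suffices to split a null Borel set `N` that is not covered. Parametrise part of
`N` by a continuous injection `f` of a Polish space `Y` such that no nonempty open set has a covered
image. A Baire category dichotomy (`exists_isCompact_subset_closure_diff`) then yields, for each
nonempty open `V` and each `k`, a compact `F` with `μ F > m k` and `F ⊆ closure (f '' V \ F)`. Build
a scheme of open subsets of `Y` branching over `ℕ × Bool`, where at each node the children of either
colour accumulate, through `f`, at all of such an `F`. The branches with colour sequence `c` form `φ
c`. If countably many compact sets covered `φ c`, Baire's theorem in `ℕ → ℕ` would put a whole
cylinder into one of them; being closed, it would contain the sets `F` of deep nodes and be too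
large. The reductions to null sets use inner regularity for `Jf`, and a null dense `G_δ` in the
support of a restricted measure for `J0`. -/

/-- `A` is covered by countably many compact sets, each of measure at most some `m k`. -/
def CoveredBy {X : Type*} [TopologicalSpace X] [MeasurableSpace X] (m : ℕ → ℝ≥0∞)
    (μ : Measure X) (A : Set X) : Prop :=
  ∃ S : Set (Set X), S.Countable ∧ (∀ K ∈ S, IsCompact K ∧ ∃ k, μ K ≤ m k) ∧ A ⊆ ⋃₀ S

/-! ### The σ-ideal of covered sets -/

section CoveredBy

variable {X : Type*} [TopologicalSpace X] [MeasurableSpace X] {m : ℕ → ℝ≥0∞} {μ : Measure X}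

lemma CoveredBy.mono {A B : Set X} (h : CoveredBy m μ B) (hAB : A ⊆ B) : CoveredBy m μ A := by
  obtain ⟨S, h1, h2, h3⟩ := h
  exact ⟨S, h1, h2, hAB.trans h3⟩

lemma CoveredBy.sUnion {T : Set (Set X)} (hT : T.Countable) (h : ∀ A ∈ T, CoveredBy m μ A) :
    CoveredBy m μ (⋃₀ T) := by
  choose! S h1 h2 h3 using h
  refine ⟨⋃ A ∈ T, S A, hT.biUnion h1, ?_, ?_⟩
  · intro K hK
    simp only [mem_iUnion] at hK
    obtain ⟨A, hA, hK⟩ := hK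
    exact h2 A hA K hK
  · rintro x ⟨A, hA, hx⟩
    obtain ⟨K, hK, hxK⟩ := h3 A hA hx
    exact ⟨K, mem_biUnion hA hK, hxK⟩

lemma CoveredBy.union {A B : Set X} (hA : CoveredBy m μ A) (hB : CoveredBy m μ B) :
    CoveredBy m μ (A ∪ B) := by
  rw [← sUnion_pair]
  apply CoveredBy.sUnion (by simp)
  rintro C (rfl | rfl) <;> assumption

lemma coveredBy_of_isCompact {K : Set X} {k : ℕ} (hK : IsCompact K) (h : μ K ≤ m k) :
    CoveredBy m μ K :=
  ⟨{K}, countable_singleton K, by rintro _ rfl; exact ⟨hK, k, h⟩, by simp⟩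

lemma coveredBy_iff_exists_seq {A : Set X} : CoveredBy m μ A ↔
    ∃ K : ℕ → Set X, (∀ n, IsCompact (K n) ∧ ∃ k, μ (K n) ≤ m k) ∧ A ⊆ ⋃ n, K n := by
  constructor
  · rintro ⟨S, h1, h2, h3⟩
    -- Adjoining `∅` makes the family nonempty, so that a sequence can enumerate it.
    obtain ⟨K, hK⟩ := (h1.insert ∅).exists_eq_range (insert_nonempty _ _)
    refine ⟨K, fun n => ?_, ?_⟩
    · have : K n ∈ insert ∅ S := hK ▸ mem_range_self n
      rcases this with h | h
      · rw [h]
        exact ⟨isCompact_empty, 0, by simp⟩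
      · exact h2 _ h
    · rw [← sUnion_range, ← hK]
      exact h3.trans (sUnion_subset_sUnion (subset_insert _ _))
  · rintro ⟨K, h1, h2⟩
    exact ⟨range K, countable_range K, by rintro _ ⟨n, rfl⟩; exact h1 n, by rwa [sUnion_range]⟩

lemma mem_Jf_iff {A : Set X} :
    A ∈ Jf μ ↔ MeasurableSet A ∧ CoveredBy (fun k => (k : ℝ≥0∞)) μ A := by
  rw [coveredBy_iff_exists_seq]
  have (K : Set X) : μ K < ⊤ ↔ ∃ k : ℕ, μ K ≤ k := by
    constructor
    · intro h
      obtain ⟨n, hn⟩ := ENNReal.exists_nat_gt h.ne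
      exact ⟨n, hn.le⟩
    · rintro ⟨k, hk⟩
      exact hk.trans_lt (ENNReal.natCast_lt_top k)
  simp only [Jf, mem_ofPred, this]

lemma mem_J0_iff {A : Set X} :
    A ∈ J0 μ ↔ MeasurableSet A ∧ CoveredBy (fun _ => 0) μ A := by
  rw [coveredBy_iff_exists_seq]
  simp [J0]

end CoveredBy

/-! ### Polish parametrisations -/

/-- A Borel set in a Polish space is the image of a Polish space under a continuous injection. -/
lemma exists_polishSpace_injective_range_eq {X : Type*} [tX : TopologicalSpace X] [PolishSpace X]
    [MeasurableSpace X] [BorelSpace X] {N : Set X} (hN : MeasurableSet N) :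
    ∃ (Y : Set X) (_ : TopologicalSpace Y) (_ : PolishSpace Y) (f : Y → X),
      Continuous f ∧ Function.Injective f ∧ range f = N := by
  obtain ⟨t, ht, hp, hc, -⟩ := hN.isClopenable
  refine ⟨N, @instTopologicalSpaceSubtype X N t, @IsClosed.polishSpace X t hp N hc,
    Subtype.val, ?_, Subtype.val_injective, Subtype.range_val⟩
  exact @Continuous.comp N X X (@instTopologicalSpaceSubtype X N t) t tX _ _
    (continuous_id_of_le ht) (@continuous_subtype_val X t N)

/-- A Borel set that is not covered contains a continuous injective image of a nonempty Polish
space such that no nonempty open set has covered image. -/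
lemma exists_polishSpace_forall_isOpen_not_coveredBy {X : Type u} [TopologicalSpace X]
    [PolishSpace X] [MeasurableSpace X] [BorelSpace X] {m : ℕ → ℝ≥0∞} {μ : Measure X}
    {N : Set X} (hN : MeasurableSet N) (hcov : ¬ CoveredBy m μ N) :
    ∃ (Y : Type u) (_ : TopologicalSpace Y) (_ : PolishSpace Y) (f : Y → X),
      Continuous f ∧ Function.Injective f ∧ range f ⊆ N ∧ Nonempty Y ∧
      ∀ V : Set Y, IsOpen V → V.Nonempty → ¬ CoveredBy m μ (f '' V) := by
  obtain ⟨Z, _, _, f, hf, hfi, rfl⟩ := exists_polishSpace_injective_range_eq hN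
  let T : Set (Set Z) := {V | IsOpen V ∧ CoveredBy m μ (f '' V)}
  -- By the Lindelöf property, the union of all open sets with covered image again has covered
  -- image; it is then removed.
  obtain ⟨T', hT'c, hT'T, hT'⟩ := TopologicalSpace.isOpen_sUnion_countable T (fun V hV => hV.1)
  have hTopen : IsOpen (⋃₀ T) := isOpen_sUnion fun V hV => hV.1
  have hTcov : CoveredBy m μ (f '' ⋃₀ T) := by
    rw [← hT', sUnion_eq_biUnion, image_iUnion₂, ← sUnion_image (fun V => f '' V) T']
    apply CoveredBy.sUnion (hT'c.image _)
    rintro _ ⟨V, hV, rfl⟩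
    exact (hT'T hV).2
  have hP : IsClosed (⋃₀ T)ᶜ := hTopen.isClosed_compl
  refine ⟨↥(⋃₀ T)ᶜ, inferInstance, hP.polishSpace, f ∘ Subtype.val,
    hf.comp continuous_subtype_val, hfi.comp Subtype.val_injective, ?_, ?_, ?_⟩
  · rintro _ ⟨y, rfl⟩
    exact mem_range_self _
  · rw [nonempty_coe_sort]
    by_contra h
    rw [not_nonempty_iff_eq_empty, compl_empty_iff] at h
    rw [h, image_univ] at hTcov
    exact hcov hTcov
  · rintro V hV ⟨y, hy⟩ hVc
    obtain ⟨O, hO, rfl⟩ := isOpen_induced_iff.1 hV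
    refine y.2 (mem_sUnion_of_mem (t := O) hy ⟨hO, ?_⟩)
    refine (hVc.union hTcov).mono ?_
    rintro _ ⟨z, hz, rfl⟩
    by_cases h : z ∈ ⋃₀ T
    · exact Or.inr ⟨z, h, rfl⟩
    · exact Or.inl ⟨⟨z, h⟩, hz, rfl⟩

/-! ### Accumulation on large compact sets -/

/-- A null Borel set, no nonempty relatively open subset of which is covered, accumulates
on a large compact set from its outside. -/
lemma exists_isCompact_subset_closure_diff {X : Type*} [TopologicalSpace X] [CompactSpace X]
    [TopologicalSpace.MetrizableSpace X] [MeasurableSpace X] [BorelSpace X] {m : ℕ → ℝ≥0∞}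
    {μ : Measure X} {A : Set X} (hA : MeasurableSet A) (hμ : μ A = 0) (hne : A.Nonempty)
    (hcov : ∀ W : Set X, IsOpen W → (A ∩ W).Nonempty → ¬ CoveredBy m μ (A ∩ W)) (k : ℕ) :
    ∃ F : Set X, IsCompact F ∧ m k < μ F ∧ F ⊆ closure (A \ F) := by
  set E := closure A with hE
  let A' : Set E := Subtype.val ⁻¹' A
  have hA'd : Dense A' := by
    rw [Subtype.dense_iff, Subtype.image_preimage_coe, inter_eq_right.2 subset_closure]
  have hEcl : IsClosed E := isClosed_closure
  have hEc : CompactSpace E := isCompact_iff_compactSpace.1 hEcl.isCompact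
  have push {t : Set E} {e : E} (he : e ∈ closure t) : (e : X) ∈ closure (Subtype.val '' t) :=
    closure_subtype.1 he
  by_cases hm : IsMeagre A'
  -- Meagre case: `F` is the closure of one of the nowhere dense pieces. If all these closures had
  -- measure at most `m k`, they would cover `A`.
  · obtain ⟨S, hS, hSc, hSA⟩ := isMeagre_iff_countable_union_isNowhereDense.1 hm
    have hA1 : ¬ CoveredBy m μ A := by
      simpa using hcov univ isOpen_univ (by simpa using hne)
    obtain ⟨t, htS, ht⟩ : ∃ t ∈ S, m k < μ (Subtype.val '' closure t) := by
      by_contra! hcon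
      refine hA1 ⟨(fun t => Subtype.val '' closure t) '' S, hSc.image _, ?_, ?_⟩
      · rintro _ ⟨t, ht, rfl⟩
        exact ⟨isClosed_closure.isCompact.image continuous_subtype_val, k, hcon t ht⟩
      · intro x hx
        obtain ⟨t, ht, hxt⟩ := hSA (show (⟨x, subset_closure hx⟩ : E) ∈ A' from hx)
        exact ⟨_, mem_image_of_mem _ ht, ⟨_, subset_closure hxt, rfl⟩⟩
    refine ⟨_, isClosed_closure.isCompact.image continuous_subtype_val, ht, ?_⟩
    have hd : Dense (A' ∩ (closure t)ᶜ) := by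
      have h := isClosed_isNowhereDense_iff_compl.1 ⟨isClosed_closure, (hS t htS).closure⟩
      exact hA'd.inter_of_isOpen_right h.2 h.1
    rintro _ ⟨e, he, rfl⟩
    refine closure_mono ?_ (push (hd e))
    rintro _ ⟨z, hz, rfl⟩
    refine ⟨hz.1, ?_⟩
    rintro ⟨w, hw, hwz⟩
    exact hz.2 (Subtype.ext hwz ▸ hw)
  -- Nonmeagre case: `A` contains `U ∩ R` with `U` nonempty open and `R` a dense `G_δ`. As `A` is
  -- null, a large closed `C ⊆ U` stays large outside `R`, and `F` is a compact part of `C \ R`.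
  · obtain ⟨U, hU, hAU⟩ := (hA.preimage measurable_subtype_coe : MeasurableSet A').residualEq_isOpen
    obtain ⟨R, hRsub, hRG, hRd⟩ := mem_residual.1 (hAU.mem_iff : _ ∈ residual E)
    have hUne : U.Nonempty := by
      by_contra h
      rw [not_nonempty_iff_eq_empty] at h
      apply hm
      rw [h] at hAU
      have := hAU.mem_iff
      filter_upwards [this] with x hx hxA
      exact hx.1 hxA
    obtain ⟨e, he⟩ := hUne
    obtain ⟨C, hCe, hCcl, hCU⟩ := exists_mem_nhds_isClosed_subset (hU.mem_nhds he)
    have hRA : U ∩ R ⊆ A' := fun x hx => (hRsub hx.2).2 hx.1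
    have hlarge : ∀ k, m k < μ (Subtype.val '' C) := by
      intro k
      by_contra! hk
      obtain ⟨W, hW, hWC⟩ := isOpen_induced_iff.1 (isOpen_interior (s := C))
      have heW : (e : X) ∈ W := by
        have : e ∈ Subtype.val ⁻¹' W := hWC ▸ mem_interior_iff_mem_nhds.2 hCe
        exact this
      have hWA : (A ∩ W).Nonempty := by
        rw [inter_comm]
        exact mem_closure_iff.1 e.2 W hW heW
      refine hcov W hW hWA
        ((coveredBy_of_isCompact (hCcl.isCompact.image continuous_subtype_val) hk).mono ?_)
      rintro x ⟨hxA, hxW⟩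
      have : (⟨x, subset_closure hxA⟩ : E) ∈ interior C := by
        rw [← hWC]
        exact hxW
      exact ⟨_, interior_subset this, rfl⟩
    obtain ⟨O, hO, rfl⟩ := isGδ_iff_eq_iInter_nat.1 hRG
    have hCO n : IsCompact (Subtype.val '' (C \ O n) : Set X) :=
      (hCcl.sdiff (hO n)).isCompact.image continuous_subtype_val
    have hkey : m k < μ (⋃ n, (Subtype.val '' (C \ O n) : Set X)) := by
      refine (hlarge k).trans_le ?_
      have hsub : (Subtype.val '' C : Set X) ⊆ (⋃ n, Subtype.val '' (C \ O n)) ∪ A := by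
        rintro _ ⟨z, hz, rfl⟩
        by_cases hzO : z ∈ ⋂ n, O n
        · exact Or.inr (hRA ⟨hCU hz, hzO⟩)
        · simp only [mem_iInter, not_forall] at hzO
          obtain ⟨n, hn⟩ := hzO
          exact Or.inl (mem_iUnion.2 ⟨n, z, ⟨hz, hn⟩, rfl⟩)
      exact (measure_mono hsub).trans ((measure_union_le _ _).trans (by simp [hμ]))
    -- Continuity from below: finitely many of the compact sets `C \ O n` already have measure above
    -- `m k`.
    rw [measure_iUnion_eq_iSup_accumulate, lt_iSup_iff] at hkey
    obtain ⟨n, hn⟩ := hkey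
    refine ⟨_, ?_, hn, ?_⟩
    · exact isCompact_accumulate hCO n
    · intro x hx
      have hF : ∀ z : E, (z : X) ∈ accumulate (fun n => (Subtype.val '' (C \ O n) : Set X)) n →
          z ∈ U ∧ z ∉ ⋂ n, O n := by
        intro z hz
        obtain ⟨i, -, w, hw, hwz⟩ := mem_accumulate.1 hz
        obtain rfl := Subtype.ext hwz
        exact ⟨hCU hw.1, fun h => hw.2 (mem_iInter.1 h i)⟩
      obtain ⟨i, -, w, hw, rfl⟩ := mem_accumulate.1 hx
      refine closure_mono ?_ (push (hRd.open_subset_closure_inter hU (hCU hw.1)))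
      rintro _ ⟨z, hz, rfl⟩
      exact ⟨hRA hz, fun h => (hF z h).2 hz.2⟩

/-! ### Disjoint open sets accumulating at a compact set -/

/-- Near a compact set `F` on which `f '' V \ F` accumulates one finds disjoint open subsets of `V`
whose images approximate prescribed points of `F`. -/
lemma exists_seq_pairwise_disjoint_isOpen {X Y : Type*} [PseudoMetricSpace X]
    [PseudoMetricSpace Y] {f : Y → X} (hf : Continuous f) {V : Set Y} (hV : IsOpen V) {F : Set X}
    (hF : IsClosed F) (hVF : F ⊆ closure (f '' V \ F)) {δ : ℝ} (hδ : 0 < δ) {p : ℕ → X}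
    (hp : ∀ n, p n ∈ F) {t : ℕ → ℝ} (ht : ∀ n, 0 < t n) :
    ∃ W : ℕ → Set Y, (∀ n, IsOpen (W n) ∧ (W n).Nonempty ∧ closure (W n) ⊆ V ∧
      Metric.ediam (W n) ≤ ENNReal.ofReal δ ∧ ∀ z ∈ W n, dist (f z) (p n) < t n) ∧
      Pairwise fun i j => Disjoint (W i) (W j) := by
  have hFne : F.Nonempty := ⟨_, hp 0⟩
  have hpick (n : ℕ) (ε : ℝ) (hε : 0 < ε) :
      ∃ y ∈ V, 0 < Metric.infDist (f y) F ∧ Metric.infDist (f y) F < ε ∧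
        dist (f y) (p n) < t n := by
    obtain ⟨_, ⟨⟨y, hy, rfl⟩, hyF⟩, hd⟩ :=
      Metric.mem_closure_iff.1 (hVF (hp n)) (min ε (t n)) (lt_min hε (ht n))
    rw [dist_comm, lt_min_iff] at hd
    exact ⟨y, hy, (hF.notMem_iff_infDist_pos hFne).1 hyF,
      (Metric.infDist_le_dist_of_mem (hp n)).trans_lt hd.1, hd.2⟩
  choose pick hpV hpos hlt hdist using hpick
  let d : Y → ℝ := fun y => Metric.infDist (f y) F
  have hd : Continuous d := (Metric.continuous_infDist_pt F).comp hf
  let st : ℕ → {y : Y // 0 < d y} := fun n => Nat.rec ⟨pick 0 1 one_pos, hpos _ _ _⟩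
    (fun n y => ⟨pick (n + 1) (d y / 3) (div_pos y.2 three_pos), hpos _ _ _⟩) n
  let y : ℕ → Y := fun n => (st n).1
  have hyd n : 0 < d (y n) := (st n).2
  have hyV n : y n ∈ V := by
    cases n with
    | zero => exact hpV _ _ _
    | succ n => exact hpV _ _ _
  have hyp n : dist (f (y n)) (p n) < t n := by
    cases n with
    | zero => exact hdist _ _ _
    | succ n => exact hdist _ _ _
  -- The distances to `F` shrink by a factor above 3, so the intervals `(d/2, 3d/2)` around them are
  -- disjoint, and so are the sets `W n` mapped into them.
  have hys n : d (y (n + 1)) < d (y n) / 3 := hlt _ _ _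
  have hanti : StrictAnti fun n => d (y n) := by
    refine strictAnti_nat_of_succ_lt fun n => ?_
    linarith [hys n, hyd n]
  have hysl {i j : ℕ} (hij : i < j) : d (y j) < d (y i) / 3 :=
    (hanti.antitone (Nat.succ_le_of_lt hij)).trans_lt (hys i)
  have hnhds n : V ∩ d ⁻¹' Ioo (d (y n) / 2) (3 * d (y n) / 2) ∩
      {z | dist (f z) (p n) < t n} ∩ Metric.ball (y n) (δ / 2) ∈ 𝓝 (y n) := by
    refine inter_mem (inter_mem (inter_mem (hV.mem_nhds (hyV n)) ?_) ?_) ?_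
    · exact hd.continuousAt.preimage_mem_nhds
        (Ioo_mem_nhds (by linarith [hyd n]) (by linarith [hyd n]))
    · exact (isOpen_lt (hf.dist continuous_const) continuous_const).mem_nhds (hyp n)
    · exact Metric.ball_mem_nhds _ (half_pos hδ)
  choose r hr hrsub using fun n => Metric.nhds_basis_closedBall.mem_iff.1 (hnhds n)
  have hsub n := Metric.ball_subset_closedBall.trans (hrsub n)
  refine ⟨fun n => Metric.ball (y n) (r n), fun n => ⟨Metric.isOpen_ball,
    ⟨y n, Metric.mem_ball_self (hr n)⟩, ?_, ?_, fun z hz => (hsub n hz).1.2⟩, ?_⟩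
  · exact Metric.closure_ball_subset_closedBall.trans ((hrsub n).trans fun z hz => hz.1.1.1)
  · refine (Metric.ediam_mono fun z hz => (hsub n hz).2).trans ?_
    refine Metric.ediam_le fun a ha b hb => ?_
    rw [edist_dist]
    apply ENNReal.ofReal_le_ofReal
    have := dist_triangle_right a b (y n)
    linarith [Metric.mem_ball.1 ha, Metric.mem_ball.1 hb]
  · have key {i j : ℕ} (hij : i < j) :
        Disjoint (Metric.ball (y i) (r i)) (Metric.ball (y j) (r j)) := by
      rw [Set.disjoint_left]
      intro z hi hj
      have h1 := (hsub i hi).1.1.2.1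
      have h2 := (hsub j hj).1.1.2.2
      linarith [hysl hij]
    intro i j hij
    rcases lt_or_gt_of_ne hij with h | h
    · exact key h
    · exact (key h).symm

/-- Near a compact set `F` on which `f '' V \ F` accumulates one finds two sequences of disjoint
open subsets of `V` such that the images of any selection from either accumulate at all of `F`. -/
lemma exists_disjoint_isOpen_subset_closure_range {X Y : Type*} [MetricSpace X]
    [PseudoMetricSpace Y] {f : Y → X} (hf : Continuous f) {V : Set Y} (hV : IsOpen V) {F : Set X}
    (hF : IsCompact F) (hFne : F.Nonempty) (hVF : F ⊆ closure (f '' V \ F)) {δ : ℝ} (hδ : 0 < δ) :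
    ∃ W : ℕ × Bool → Set Y, (∀ i, IsOpen (W i) ∧ (W i).Nonempty ∧ closure (W i) ⊆ V ∧
      Metric.ediam (W i) ≤ ENNReal.ofReal δ) ∧ (Pairwise fun i j => Disjoint (W i) (W j)) ∧
      ∀ b, ∀ g : ℕ → Y, (∀ n, g n ∈ W (n, b)) → F ⊆ closure (range (f ∘ g)) := by
  have := hFne.to_subtype
  have := isCompact_iff_compactSpace.1 hF
  let q := TopologicalSpace.denseSeq F
  obtain ⟨e⟩ : Nonempty (ℕ × Bool ≃ ℕ) := nonempty_equiv_of_countable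
  obtain ⟨W, hW, hdisj⟩ := exists_seq_pairwise_disjoint_isOpen hf hV hF.isClosed hVF hδ
    -- For each colour, the index `Nat.pair a k` targets the dense point `q a` with precision `1 /
    -- (k + 1)`.
    (p := fun n => q (e.symm n).1.unpair.1) (fun n => Subtype.coe_prop _)
    (t := fun n => 1 / (((e.symm n).1.unpair.2 : ℝ) + 1)) (fun n => Nat.one_div_pos_of_nat)
  refine ⟨fun i => W (e i), fun i => ?_, fun i j hij => hdisj (e.injective.ne hij), ?_⟩
  · obtain ⟨h1, h2, h3, h4, -⟩ := hW (e i)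
    exact ⟨h1, h2, h3, h4⟩
  · intro b g hg x hx
    rw [Metric.mem_closure_iff]
    intro ε hε
    obtain ⟨k, hk⟩ := exists_nat_one_div_lt (half_pos hε)
    obtain ⟨a, ha⟩ := Metric.denseRange_iff.1 (TopologicalSpace.denseRange_denseSeq F) ⟨x, hx⟩
      (ε / 2) (half_pos hε)
    refine ⟨_, mem_range_self (Nat.pair a k), ?_⟩
    have h := (hW (e (Nat.pair a k, b))).2.2.2.2 _ (hg _)
    simp only [Equiv.symm_apply_apply, Nat.unpair_pair] at h
    have ha' : dist x (q a) < ε / 2 := ha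
    have := dist_triangle_right x (f (g (Nat.pair a k))) (q a)
    simp only [Function.comp_apply]
    linarith

/-! ### The scheme and its coloured branches -/

/-- If all nonempty open sets have images that accumulate on large compact sets, there are
continuum many disjoint Borel sets that are not covered. -/
lemma exists_disjoint_not_coveredBy_of_isOpen {X Y : Type*} [TopologicalSpace X]
    [TopologicalSpace.MetrizableSpace X] [MeasurableSpace X] [BorelSpace X]
    [TopologicalSpace Y] [PolishSpace Y] [Nonempty Y] {m : ℕ → ℝ≥0∞} (hm : Monotone m)
    {μ : Measure X} {f : Y → X} (hf : Continuous f) (hfi : Function.Injective f)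
    (hacc : ∀ V : Set Y, IsOpen V → V.Nonempty → ∀ k, ∃ F : Set X, IsCompact F ∧ m k < μ F ∧
      F ⊆ closure (f '' V \ F)) :
    ∃ φ : (ℕ → Bool) → Set X, (∀ c, φ c ⊆ range f ∧ MeasurableSet (φ c) ∧
      ¬ CoveredBy m μ (φ c)) ∧ ∀ c d, c ≠ d → φ c ∩ φ d = ∅ := by
  let := TopologicalSpace.metrizableSpaceMetric X
  let := TopologicalSpace.upgradeIsCompletelyMetrizable Y
  have hchild (V : {V : Set Y // IsOpen V ∧ V.Nonempty}) (k : ℕ) :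
      ∃ (F : Set X) (W : ℕ × Bool → Set Y), m k < μ F ∧
        (∀ i, IsOpen (W i) ∧ (W i).Nonempty ∧ closure (W i) ⊆ V ∧
          Metric.ediam (W i) ≤ ENNReal.ofReal ((1 / 2) ^ k)) ∧
        (Pairwise fun i j => Disjoint (W i) (W j)) ∧
        ∀ b, ∀ g : ℕ → Y, (∀ n, g n ∈ W (n, b)) → F ⊆ closure (range (f ∘ g)) := by
    obtain ⟨F, hFc, hF, hVF⟩ := hacc V V.2.1 V.2.2 k
    have hFne : F.Nonempty := nonempty_of_measure_ne_zero (pos_of_gt hF).ne'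
    obtain ⟨W, hW⟩ := exists_disjoint_isOpen_subset_closure_range hf V.2.1 hFc hFne hVF
      (show (0 : ℝ) < (1 / 2) ^ k by positivity)
    exact ⟨F, W, hF, hW⟩
  choose F W hF hW hWd hWF using hchild
  let D : List (ℕ × Bool) → {V : Set Y // IsOpen V ∧ V.Nonempty} := fun l =>
    List.rec ⟨univ, isOpen_univ, univ_nonempty⟩
      (fun a l V => ⟨W V l.length a, (hW V l.length a).1, (hW V l.length a).2.1⟩) l
  let A : List (ℕ × Bool) → Set Y := fun l => (D l).1
  have hA l a : A (a :: l) = W (D l) l.length a := rfl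
  have hanti : CantorScheme.ClosureAntitone A := fun l a => (hW (D l) l.length a).2.2.1
  have hdiam : CantorScheme.VanishingDiam A := by
    intro x
    -- The root `univ` has no diameter bound; the bounds start at depth one.
    rw [← tendsto_add_atTop_iff_nat 1]
    have h0 : Tendsto (fun n : ℕ => ENNReal.ofReal ((1 / 2) ^ n)) atTop (𝓝 0) := by
      rw [← ENNReal.ofReal_zero]
      exact ENNReal.tendsto_ofReal
        (tendsto_pow_atTop_nhds_zero_of_lt_one (by norm_num) (by norm_num))
    refine tendsto_of_tendsto_of_tendsto_of_le_of_le tendsto_const_nhds h0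
      (fun _ => zero_le) fun n => ?_
    have := (hW (D (PiNat.res x n)) (PiNat.res x n).length (x n)).2.2.2
    rwa [← hA, PiNat.res_length, ← PiNat.res_succ] at this
  have hdisj : CantorScheme.Disjoint A := fun l => hWd (D l) l.length
  have huniv := hanti.map_of_vanishingDiam hdiam fun l => (D l).2.2
  have hmem (x : ℕ → ℕ × Bool) : x ∈ (CantorScheme.inducedMap A).1 := huniv ▸ mem_univ x
  let h : (ℕ → ℕ × Bool) → Y := fun x => (CantorScheme.inducedMap A).2 ⟨x, hmem x⟩
  have hhi : Function.Injective h := fun x y hxy =>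
    congrArg Subtype.val (CantorScheme.Disjoint.map_injective hdisj hxy)
  have hhc : Continuous h := hdiam.map_continuous.comp (continuous_id.subtype_mk hmem)
  have hhA (x : ℕ → ℕ × Bool) (n : ℕ) : h x ∈ A (PiNat.res x n) :=
    CantorScheme.map_mem ⟨x, hmem x⟩ n
  let pr : (ℕ → Bool) → (ℕ → ℕ) → ℕ → ℕ × Bool := fun c a k => (a k, c k)
  have hprc c : Continuous (pr c) :=
    continuous_pi fun k => (continuous_apply k).prodMk continuous_const
  have hpri c : Function.Injective (pr c) := fun a b hab =>
    funext fun k => congrArg Prod.fst (congrFun hab k)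
  let g : (ℕ → Bool) → (ℕ → ℕ) → X := fun c a => f (h (pr c a))
  have hgc c : Continuous (g c) := hf.comp (hhc.comp (hprc c))
  have hgi c : Function.Injective (g c) := hfi.comp (hhi.comp (hpri c))
  refine ⟨fun c => range (g c), fun c => ⟨?_, ?_, ?_⟩, ?_⟩
  · rintro _ ⟨a, rfl⟩
    exact mem_range_self _
  -- Lusin–Souslin: an injective continuous image of a Polish space is Borel.
  · exact ((hgc c).measurableEmbedding (hgi c)).measurableSet_range
  · intro hcov
    obtain ⟨K, hK, hcov⟩ := coveredBy_iff_exists_seq.1 hcov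
    obtain ⟨i, a, ha⟩ := nonempty_interior_of_iUnion_of_closed
      (f := fun i => g c ⁻¹' K i) (fun i => (hK i).1.isClosed.preimage (hgc c)) (by
        rwa [← preimage_iUnion, preimage_eq_univ_iff])
    obtain ⟨hKc, k, hk⟩ := hK i
    obtain ⟨_, ⟨x, n, rfl⟩, hax, hsub⟩ :=
      (PiNat.isTopologicalBasis_cylinders fun _ : ℕ => ℕ).mem_nhds_iff.1
        (mem_interior_iff_mem_nhds.1 ha)
    -- Depth at least `n` keeps the modified branches in the cylinder; depth at least `k` gives `m k
    -- ≤ m N`.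
    let N := max n k
    let l := PiNat.res (pr c a) N
    have hFK : F (D l) N ⊆ K i := by
      -- Varying only coordinate `N` of `a` selects one point in each child of colour `c N`.
      refine (hWF (D l) N (c N) (fun j => h (pr c (Function.update a N j))) fun j => ?_).trans
        (closure_minimal ?_ hKc.isClosed)
      · have hmem := hhA (pr c (Function.update a N j)) (N + 1)
        have hres : PiNat.res (pr c (Function.update a N j)) N = l := by
          rw [PiNat.res_eq_res]
          intro j hj
          simp [pr, Function.update_of_ne hj.ne]
        rw [PiNat.res_succ, hres, hA, PiNat.res_length] at hmem
        simpa [pr] using hmem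
      · rintro _ ⟨j, rfl⟩
        refine hsub fun i hi => ?_
        rw [Function.update_of_ne (hi.trans_le (le_max_left n k)).ne]
        exact hax i hi
    exact absurd (hF (D l) N)
      (not_lt.2 ((measure_mono hFK).trans (hk.trans (hm (le_max_right n k)))))
  · intro c d hcd
    by_contra hne
    obtain ⟨_, ⟨a, rfl⟩, b, hb⟩ := nonempty_iff_ne_empty.2 hne
    have := hhi (hfi hb)
    exact hcd (funext fun k => (congrArg Prod.snd (congrFun this k)).symm)

/-- A null Borel set that is not covered contains continuum many disjoint Borel sets that are not
covered. -/
lemma exists_disjoint_not_coveredBy_of_measure_eq_zero {X : Type u} [TopologicalSpace X]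
    [CompactSpace X] [TopologicalSpace.MetrizableSpace X] [MeasurableSpace X] [BorelSpace X]
    {m : ℕ → ℝ≥0∞} (hm : Monotone m) {μ : Measure X} {N : Set X} (hN : MeasurableSet N)
    (hμ : μ N = 0) (hcov : ¬ CoveredBy m μ N) :
    ∃ φ : (ℕ → Bool) → Set X, (∀ c, φ c ⊆ N ∧ MeasurableSet (φ c) ∧
      ¬ CoveredBy m μ (φ c)) ∧ ∀ c d, c ≠ d → φ c ∩ φ d = ∅ := by
  let := TopologicalSpace.metrizableSpaceMetric X
  have : PolishSpace X := inferInstance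
  obtain ⟨Y, _, _, f, hf, hfi, hfN, _, hY⟩ :=
    exists_polishSpace_forall_isOpen_not_coveredBy hN hcov
  obtain ⟨φ, h1, h2⟩ := exists_disjoint_not_coveredBy_of_isOpen hm (μ := μ) hf hfi (by
    intro V hV hVne k
    borelize Y
    refine exists_isCompact_subset_closure_diff
      ((hf.measurableEmbedding hfi).measurableSet_image.2 hV.measurableSet)
      (measure_mono_null ((image_subset_range f V).trans hfN) hμ) (hVne.image f) ?_ k
    rintro W hW hne
    -- A relatively open part of `f '' V` is itself the image of an open set.
    rw [← image_inter_preimage] at hne ⊢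
    exact hY _ (hV.inter (hW.preimage hf)) (image_nonempty.1 hne))
  exact ⟨φ, fun c => ⟨(h1 c).1.trans hfN, (h1 c).2⟩, h2⟩

/-! ### Reductions to null sets -/

section Reductions

variable {X : Type*} [TopologicalSpace X] [CompactSpace X] [TopologicalSpace.MetrizableSpace X]
  [MeasurableSpace X] [BorelSpace X] {μ : Measure X}

/-- A Borel set of finite measure is a countable union of compact sets up to a null set. -/
lemma exists_isCompact_measure_diff_iUnion_eq_zero {C : Set X} (hC : MeasurableSet C)
    (hμ : μ C < ⊤) :
    ∃ K : ℕ → Set X, (∀ n, IsCompact (K n) ∧ K n ⊆ C) ∧ μ (C \ ⋃ n, K n) = 0 := by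
  let := TopologicalSpace.metrizableSpaceMetric X
  have : IsFiniteMeasure (μ.restrict C) := isFiniteMeasure_restrict.2 hμ.ne
  have hK (n : ℕ) := hC.exists_isClosed_sdiff_lt (μ := μ.restrict C) (measure_ne_top _ _)
    (ε := ((n : ℝ≥0∞) + 1)⁻¹) (by simp)
  choose K hKC hK hKlt using hK
  refine ⟨K, fun n => ⟨(hK n).isCompact, hKC n⟩, ?_⟩
  by_contra hne
  obtain ⟨n, hn⟩ := ENNReal.exists_inv_nat_lt hne
  have h1 := hKlt n
  rw [Measure.restrict_eq_self μ sdiff_subset] at h1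
  refine ((measure_mono (sdiff_subset_sdiff_right (subset_iUnion K n))).trans_lt
    (h1.trans (lt_of_le_of_lt ?_ hn))).false
  exact ENNReal.inv_le_inv.2 le_self_add

/-- A Borel set of finite measure that is not in `Jf` contains a null Borel set not in `Jf`. -/
lemma exists_null_subset_not_mem_Jf {C : Set X} (hC : MeasurableSet C) (hμ : μ C < ⊤)
    (hJ : C ∉ Jf μ) : ∃ N ⊆ C, MeasurableSet N ∧ μ N = 0 ∧ N ∉ Jf μ := by
  obtain ⟨K, hK, hnull⟩ := exists_isCompact_measure_diff_iUnion_eq_zero hC hμ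
  have hKm : MeasurableSet (⋃ n, K n) := MeasurableSet.iUnion fun n => (hK n).1.measurableSet
  refine ⟨C \ ⋃ n, K n, sdiff_subset, hC.diff hKm, hnull, fun hN => hJ ?_⟩
  have hKJ : ⋃ n, K n ∈ Jf μ :=
    ⟨hKm, K, fun n => ⟨(hK n).1, (measure_mono (hK n).2).trans_lt hμ⟩, Subset.rfl⟩
  rw [mem_Jf_iff] at hN hKJ ⊢
  exact ⟨hC, (hN.2.union hKJ.2).mono (by simp)⟩

/-- Under a measure without point masses, a countable set in a set of finite measure has a null
`G_δ` neighbourhood in that set. -/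
lemma exists_isOpen_measure_inter_iInter_eq_zero [NullSingletonClass μ] {K D : Set X}
    (hμ : μ K < ⊤) (hD : D.Countable) :
    ∃ O : ℕ → Set X, (∀ n, IsOpen (O n) ∧ D ⊆ O n) ∧ μ (K ∩ ⋂ n, O n) = 0 := by
  let := TopologicalSpace.metrizableSpaceMetric X
  have : IsFiniteMeasure (μ.restrict K) := isFiniteMeasure_restrict.2 hμ.ne
  have hD0 : μ.restrict K D = 0 :=
    le_antisymm ((Measure.restrict_apply_le K D).trans (hD.measure_zero μ).le) zero_le
  have hO (n : ℕ) := D.exists_isOpen_lt_of_lt (μ := μ.restrict K) ((n : ℝ≥0∞) + 1)⁻¹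
    (by rw [hD0]; simp)
  choose O hDO hO hlt using hO
  refine ⟨O, fun n => ⟨hO n, hDO n⟩, ?_⟩
  by_contra hne
  obtain ⟨n, hn⟩ := ENNReal.exists_inv_nat_lt hne
  have h1 := hlt n
  rw [Measure.restrict_apply (hO n).measurableSet, inter_comm] at h1
  refine ((measure_mono (inter_subset_inter_right K (iInter_subset O n))).trans_lt
    (h1.trans (lt_of_le_of_lt ?_ hn))).false
  exact ENNReal.inv_le_inv.2 le_self_add

/-- A compact set of finite positive measure contains a nonempty compact set whose nonempty
relatively open subsets have positive measure. -/
lemma exists_isCompact_subset_forall_isOpen_measure_pos {K : Set X} (hK : IsCompact K)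
    (hpos : 0 < μ K) : ∃ L ⊆ K, IsCompact L ∧ L.Nonempty ∧
      ∀ W : Set X, IsOpen W → (L ∩ W).Nonempty → 0 < μ (L ∩ W) := by
  let := TopologicalSpace.metrizableSpaceMetric X
  have hsupp : (μ.restrict K).support ∈ ae (μ.restrict K) := Measure.support_mem_ae
  have hKs : (μ.restrict K).support ⊆ K :=
    Measure.support_subset_of_isClosed hK.isClosed (ae_restrict_mem hK.measurableSet)
  have hcl : IsClosed (μ.restrict K).support := Measure.isClosed_support
  refine ⟨(μ.restrict K).support, hKs, hcl.isCompact, ?_, ?_⟩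
  · exact Measure.nonempty_support fun h => hpos.ne' (Measure.restrict_eq_zero.1 h)
  · rintro W hW ⟨x, hx, hxW⟩
    have h1 := Measure.mem_support_iff_forall x |>.1 hx W (hW.mem_nhds hxW)
    have h2 : μ.restrict K W = μ.restrict K ((μ.restrict K).support ∩ W) :=
      (measure_congr (inter_ae_eq_right_of_ae_eq_univ (eventuallyEq_univ.2 hsupp))).symm
    rw [h2] at h1
    exact h1.trans_le (Measure.restrict_apply_le _ _)

/-- A compact set of finite positive measure contains a null Borel set not in `J0`. -/
lemma exists_null_subset_not_mem_J0 [NullSingletonClass μ] {K : Set X} (hK : IsCompact K)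
    (hpos : 0 < μ K) (hμ : μ K < ⊤) : ∃ N ⊆ K, MeasurableSet N ∧ μ N = 0 ∧ N ∉ J0 μ := by
  let := TopologicalSpace.metrizableSpaceMetric X
  obtain ⟨L, hLK, hL, hLne, hLpos⟩ := exists_isCompact_subset_forall_isOpen_measure_pos hK hpos
  have := isCompact_iff_compactSpace.1 hL
  have := hLne.to_subtype
  obtain ⟨D, hD, hDd⟩ := TopologicalSpace.exists_countable_dense L
  obtain ⟨O, hO, hnull⟩ := exists_isOpen_measure_inter_iInter_eq_zero
    ((measure_mono hLK).trans_lt hμ) (hD.image Subtype.val)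
  refine ⟨_, inter_subset_left.trans hLK,
    hL.measurableSet.inter (MeasurableSet.iInter fun n => (hO n).1.measurableSet), hnull, ?_⟩
  rintro ⟨-, C, hC, hcov⟩
  -- Baire in `L`: either a null set `C n` has interior in `L`, where open sets have positive
  -- measure, or the complement of some `O n` does, although `O n` contains the dense set `D`.
  obtain ⟨i, a, ha⟩ := nonempty_interior_of_iUnion_of_closed (X := L)
    (f := Sum.elim (fun n => Subtype.val ⁻¹' C n) (fun n => Subtype.val ⁻¹' (O n)ᶜ)) (by
      rintro (n | n)
      · exact (hC n).1.isClosed.preimage continuous_subtype_val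
      · exact (hO n).1.isClosed_compl.preimage continuous_subtype_val) (by
      refine eq_univ_of_forall fun x => ?_
      by_cases hx : (x : X) ∈ ⋂ n, O n
      · obtain ⟨n, hn⟩ := mem_iUnion.1 (hcov ⟨x.2, hx⟩)
        exact mem_iUnion.2 ⟨Sum.inl n, hn⟩
      · simp only [mem_iInter, not_forall] at hx
        obtain ⟨n, hn⟩ := hx
        exact mem_iUnion.2 ⟨Sum.inr n, hn⟩)
  rcases i with n | n
  · obtain ⟨W, hW, hWi⟩ := isOpen_induced_iff.1
      (isOpen_interior (s := (Subtype.val ⁻¹' C n : Set L)))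
    refine (hLpos W hW ⟨a, a.2, ?_⟩).ne' (measure_mono_null ?_ (hC n).2)
    · change a ∈ Subtype.val ⁻¹' W
      rw [hWi]
      exact ha
    · rintro x ⟨hxL, hxW⟩
      have : (⟨x, hxL⟩ : L) ∈ interior (Subtype.val ⁻¹' C n : Set L) := by
        rw [← hWi]
        exact hxW
      exact interior_subset (s := (Subtype.val ⁻¹' C n : Set L)) this
  · obtain ⟨x, hx, hxD⟩ := hDd.inter_open_nonempty _ isOpen_interior ⟨a, ha⟩
    exact interior_subset hx ((hO n).2 (mem_image_of_mem _ hxD))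

/-- For semifinite measures without point masses, a Borel set not in `J0` contains a null Borel set
not in `J0`. -/
lemma IsSemifinite.exists_null_subset_not_mem_J0 [NullSingletonClass μ] (hs : IsSemifinite μ)
    {B : Set X} (hB : MeasurableSet B) (hJ : B ∉ J0 μ) :
    ∃ N ⊆ B, MeasurableSet N ∧ μ N = 0 ∧ N ∉ J0 μ := by
  rcases eq_or_ne (μ B) 0 with h0 | h0
  · exact ⟨B, Subset.rfl, hB, h0, hJ⟩
  obtain ⟨C, hCB, hC, hCpos, hCfin⟩ := hs B hB (pos_iff_ne_zero.2 h0)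
  obtain ⟨K, hK, hnull⟩ := exists_isCompact_measure_diff_iUnion_eq_zero hC hCfin
  obtain ⟨n, hn⟩ : ∃ n, μ (K n) ≠ 0 := by
    by_contra! hcon
    refine hCpos.ne' (measure_mono_null (t := (C \ ⋃ n, K n) ∪ ⋃ n, K n) (by simp) ?_)
    exact measure_union_null hnull (measure_iUnion_null hcon)
  obtain ⟨N, hNK, hN⟩ := BorelIdeal.exists_null_subset_not_mem_J0 (hK n).1 (pos_iff_ne_zero.2 hn)
    ((measure_mono (hK n).2).trans_lt hCfin)
  exact ⟨N, hNK.trans ((hK n).2.trans hCB), hN⟩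

end Reductions

end BorelIdeal

theorem mainTheorem7 {X : Type*} [TopologicalSpace X] [CompactSpace X]
    [TopologicalSpace.MetrizableSpace X] [MeasurableSpace X] [BorelSpace X]
    (μ : Measure X) [NullSingletonClass μ] :
    ((∀ B : Set X, MeasurableSet B → B ∉ BorelIdeal.Jf μ →
        ∃ C : Set X, C ⊆ B ∧ MeasurableSet C ∧ C ∉ BorelIdeal.Jf μ ∧ μ C < ⊤) →
      ∀ B : Set X, MeasurableSet B → B ∉ BorelIdeal.Jf μ →
        ∃ φ : (ℕ → Bool) → Set X,
          (∀ c, φ c ⊆ B ∧ MeasurableSet (φ c) ∧ φ c ∉ BorelIdeal.Jf μ) ∧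
          ∀ c d, c ≠ d → φ c ∩ φ d = ∅) ∧
    (BorelIdeal.IsSemifinite μ →
      ∀ B : Set X, MeasurableSet B → B ∉ BorelIdeal.J0 μ →
        ∃ φ : (ℕ → Bool) → Set X,
          (∀ c, φ c ⊆ B ∧ MeasurableSet (φ c) ∧ φ c ∉ BorelIdeal.J0 μ) ∧
          ∀ c d, c ≠ d → φ c ∩ φ d = ∅) := by
  refine ⟨fun hfin B hB hBJ => ?_, fun hs B hB hBJ => ?_⟩
  · obtain ⟨C, hCB, hC, hCJ, hCfin⟩ := hfin B hB hBJ
    obtain ⟨N, hNC, hN, hN0, hNJ⟩ := BorelIdeal.exists_null_subset_not_mem_Jf hC hCfin hCJ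
    obtain ⟨φ, h1, h2⟩ := BorelIdeal.exists_disjoint_not_coveredBy_of_measure_eq_zero
      Nat.mono_cast hN hN0 (fun h => hNJ (BorelIdeal.mem_Jf_iff.2 ⟨hN, h⟩))
    exact ⟨φ, fun c => ⟨(h1 c).1.trans (hNC.trans hCB), (h1 c).2.1,
      fun h => (h1 c).2.2 (BorelIdeal.mem_Jf_iff.1 h).2⟩, h2⟩
  · obtain ⟨N, hNB, hN, hN0, hNJ⟩ := hs.exists_null_subset_not_mem_J0 hB hBJ
    obtain ⟨φ, h1, h2⟩ := BorelIdeal.exists_disjoint_not_coveredBy_of_measure_eq_zero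
      monotone_const hN hN0 (fun h => hNJ (BorelIdeal.mem_J0_iff.2 ⟨hN, h⟩))
    exact ⟨φ, fun c => ⟨(h1 c).1.trans hNB, (h1 c).2.1,
      fun h => (h1 c).2.2 (BorelIdeal.mem_J0_iff.1 h).2⟩, h2⟩
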